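/- Let $d$ be an odd prime. Operators on $n$ qudits are operators on $(\mathbb{C}^d)^{\otimes n}$, with computational basis labelled by $\mathbb{Z}_d^n$. Put $X|j\rangle=|j+1\rangle$, $Z|j\rangle=\omega^j|j\rangle$ with $\omega=e^{2\pi i/d}$, and $T_{(a_1,a_2)}=\omega^{-a_1a_2/2}Z^{a_1}X^{a_2}$ for $a_1,a_2\in\mathbb{Z}_d$ (the exponent being computed in $\mathbb{Z}_d$). For $u\in(\mathbb{Z}_d^2)^n$ let $T_u=T_{u_1}\otimes\cdots\otimes T_{u_n}$, $A_0=d^{-n}\sum_uT_u$ and $A_u=T_uA_0T_u^\dagger$. The discrete Wigner function of $\rho$ is $W_\rho(u)=d^{-n}\,\mathrm{Tr}(A_u\rho)$, and its mana is $\mathscr{M}(\rho)=\log\sum_u|W_\rho(u)|$. A unitary $U$ is Clifford if for every $u$ there are $\phi\in\mathbb{R}$ and $u'$ with $UT_uU^\dagger=e^{i\phi}T_{u'}$. Stabilizer states are the convex combinations of states $U|0\rangle\langle 0|U^\dagger$ with $U$ Clifford. A stabilizer protocol is a finite composition of the following operations, where each step may depend on earlier measurement outcomes and on classical randomness: Clifford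 unitaries, adjoining stabilizer states, computational basis measurement of the final qudit, and partial trace over the final qudit. At the end it announces success or failure. **Theorem.** Let $\rho$ and $\sigma$ be density operators of $a$ and $b$ qudits of dimension $d$, and let $\Lambda$ be a stabilizer protocol which, run on $\rho^{\otimes k}$, announces success with probability $p>0$, and whose output state conditioned on success is $\sigma^{\otimes m}$. Run $\Lambda$ repeatedly and independently, each time on $k$ fresh copies of $\rho$, until the first success. Let $l$ be the number of runs and $n=kl$ the number of copies of $\rho$ used. Then almost surely a success occurs, $n$ has finite expectation, and $$m\,\mathscr{M}(\sigma)\le\mathbb{E}[n]\,\mathscr{M}(\rho).$$ In particular, if $\mathscr{M}(\rho)>0$, then $$\mathbb{E}[n]\ \ge\ m\,\frac{\mathscr{M}(\sigma)}{\mathscr{M}(\rho)}.$$ -/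

import Mathlib

open MeasureTheory ProbabilityTheory

noncomputable section

namespace StabMagic

open scoped ComplexOrder

/-- Operators on `n` qudits of dimension `d`, as matrices in the computational basis, whose
vectors are labelled by strings `x : Fin n → ZMod d`. -/
abbrev Op (d n : ℕ) : Type := Matrix (Fin n → ZMod d) (Fin n → ZMod d) ℂ

/-- Density operators. -/
def IsState {d n : ℕ} [NeZero d] (ρ : Op d n) : Prop :=
  ρ.PosSemidef ∧ ρ.trace = 1

/-- `A ⊗ B`, with the qudits of `B` placed after those of `A`. -/
def tensor {d n r : ℕ} (A : Op d n) (B : Op d r) : Op d (n + r) :=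
  Matrix.of fun x y =>
    A (fun i => x (Fin.castAdd r i)) (fun i => y (Fin.castAdd r i)) *
      B (fun i => x (Fin.natAdd n i)) (fun i => y (Fin.natAdd n i))

/-- `A ⊗ ⋯ ⊗ A` (`k` factors); the `i`-th factor acts on the `i`-th block of `n` qudits. -/
def tensorPow {d n : ℕ} (A : Op d n) (k : ℕ) : Op d (k * n) :=
  Matrix.of fun x y =>
    ∏ i : Fin k, A (fun j => x (finProdFinEquiv (i, j))) (fun j => y (finProdFinEquiv (i, j)))

/-! ### Heisenberg-Weyl operators, Wigner function and mana -/

/-- The shift operator `X |j⟩ = |j + 1⟩`. -/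
def shiftX (d : ℕ) : Matrix (ZMod d) (ZMod d) ℂ :=
  Matrix.of fun x y => if x = y + 1 then 1 else 0

/-- The boost operator `Z |j⟩ = ω ^ j |j⟩`, where `ω = exp (2πi / d)`; here
`ZMod.stdAddChar j = ω ^ j`. -/
def boostZ (d : ℕ) [NeZero d] : Matrix (ZMod d) (ZMod d) ℂ :=
  Matrix.diagonal fun j => ZMod.stdAddChar j

/-- The one-qudit operator `ω ^ (-a₁ a₂ / 2) Z ^ a₁ X ^ a₂` for odd `d`; the exponent is computed
in `ZMod d`, where `2` is invertible. -/
def weyl₁ {d : ℕ} [NeZero d] (a : ZMod d × ZMod d) : Matrix (ZMod d) (ZMod d) ℂ :=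
  (ZMod.stdAddChar (-(a.1 * a.2 * 2⁻¹)) : ℂ) • (boostZ d ^ a.1.val * shiftX d ^ a.2.val)

/-- The `n`-qudit Heisenberg-Weyl operator `T_{u 0} ⊗ ⋯ ⊗ T_{u (n-1)}`. -/
def weyl {d n : ℕ} [NeZero d] (u : Fin n → ZMod d × ZMod d) : Op d n :=
  Matrix.of fun x y => ∏ i, weyl₁ (u i) (x i) (y i)

/-- The phase space point operator at the origin, `A₀ = d⁻ⁿ ∑ᵤ Tᵤ`. -/
def phasePointZero (d n : ℕ) [NeZero d] : Op d n :=
  ((d : ℂ) ^ n)⁻¹ • ∑ u : Fin n → ZMod d × ZMod d, weyl u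

/-- The phase space point operators `Aᵤ = Tᵤ A₀ Tᵤ†`. -/
def phasePoint {d n : ℕ} [NeZero d] (u : Fin n → ZMod d × ZMod d) : Op d n :=
  weyl u * phasePointZero d n * (weyl u).conjTranspose

/-- The discrete Wigner function `W_ρ(u) = d⁻ⁿ Tr (Aᵤ ρ)`. The operators `Aᵤ` are Hermitian, so
that the trace is real for Hermitian `ρ`. -/
def wigner {d n : ℕ} [NeZero d] (ρ : Op d n) (u : Fin n → ZMod d × ZMod d) : ℝ :=
  ((d : ℝ) ^ n)⁻¹ * (Matrix.trace (phasePoint u * ρ)).re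

/-- The mana `log (∑ᵤ |W_ρ(u)|)`. -/
def mana {d n : ℕ} [NeZero d] (ρ : Op d n) : ℝ :=
  Real.log (∑ u : Fin n → ZMod d × ZMod d, |wigner ρ u|)

/-! ### Clifford operators, stabilizer states and stabilizer protocols -/

/-- Clifford operators: the unitaries that take each Heisenberg-Weyl operator to a
Heisenberg-Weyl operator, up to a phase. -/
def IsClifford {d n : ℕ} [NeZero d] (U : Op d n) : Prop :=
  U ∈ Matrix.unitaryGroup (Fin n → ZMod d) ℂ ∧
    ∀ u : Fin n → ZMod d × ZMod d, ∃ (φ : ℝ) (u' : Fin n → ZMod d × ZMod d),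
      U * weyl u * U.conjTranspose = Complex.exp (Complex.I * φ) • weyl u'

/-- The projector onto the basis vector `|0 ⋯ 0⟩`. -/
def zeroState (d n : ℕ) : Op d n := Matrix.single 0 0 1

/-- The stabilizer states: the convex hull of the states `U |0⟩⟨0| U†` with `U` Clifford. -/
def stab (d n : ℕ) [NeZero d] : Set (Op d n) :=
  convexHull ℝ {S | ∃ U : Op d n, IsClifford U ∧ S = U * zeroState d n * U.conjTranspose}

/-- The projector `I ⊗ |i⟩⟨i|`, which acts on the final qudit. -/
def lastProj {d n : ℕ} (i : ZMod d) : Op d (n + 1) :=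
  Matrix.diagonal fun x => if x (Fin.last n) = i then 1 else 0

/-- The partial trace over the final qudit. -/
def traceLast {d n : ℕ} [NeZero d] (A : Op d (n + 1)) : Op d n :=
  Matrix.of fun x y =>
    ∑ c : ZMod d, A (Fin.snoc (α := fun _ => ZMod d) x c) (Fin.snoc (α := fun _ => ZMod d) y c)

/-- Stabilizer protocols from `n` to `m` qudits: finite adaptive sequences of the elementary
stabilizer operations. What follows a measurement, or a use of classical randomness, may depend on
its outcome. At the end a protocol announces success (`true`) or failure (`false`). -/
inductive StabProtocol (d : ℕ) [NeZero d] (m : ℕ) : ℕ → Type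
  /-- Stop, announce `c`, and output the `m` qudits at hand. -/
  | halt (c : Bool) : StabProtocol d m m
  /-- Apply a Clifford unitary. -/
  | clifford {n : ℕ} (U : Op d n) (hU : IsClifford U) (next : StabProtocol d m n) :
      StabProtocol d m n
  /-- Adjoin `r` qudits in a stabilizer state. -/
  | adjoin {n r : ℕ} (S : Op d r) (hS : S ∈ stab d r) (next : StabProtocol d m (n + r)) :
      StabProtocol d m n
  /-- Measure the final qudit in the computational basis; continue with `next i` on outcome `i`. -/
  | measure {n : ℕ} (next : ZMod d → StabProtocol d m (n + 1)) : StabProtocol d m (n + 1)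
  /-- Trace out the final qudit. -/
  | discard {n : ℕ} (next : StabProtocol d m n) : StabProtocol d m (n + 1)
  /-- Draw `i` with probability `q i`, and continue with `next i`. -/
  | random {n r : ℕ} (q : Fin r → ℝ) (hq : ∀ i, 0 ≤ q i) (hsum : ∑ i, q i = 1)
      (next : Fin r → StabProtocol d m n) : StabProtocol d m n

namespace StabProtocol

/-- `Λ.branch A c` is the sum, over all the runs of `Λ` on the input `A` that end with the
announcement `c`, of (probability of the run) times (normalized output state of the run). A
measurement with outcome `i` takes a state `A` to `Pᵢ A Pᵢ / Tr (A Pᵢ)` with probability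
`Tr (A Pᵢ)`, and hence contributes the unnormalized state `Pᵢ A Pᵢ`, with `Pᵢ = I ⊗ |i⟩⟨i|`. -/
def branch {d : ℕ} [NeZero d] {m : ℕ} : {n : ℕ} → StabProtocol d m n → Op d n → Bool → Op d m
  | _, halt c, A, c' => if c = c' then A else 0
  | _, clifford U _ next, A, c' => next.branch (U * A * U.conjTranspose) c'
  | _, adjoin S _ next, A, c' => next.branch (tensor A S) c'
  | _, measure next, A, c' => ∑ i, (next i).branch (lastProj i * A * lastProj i) c'
  | _, discard next, A, c' => next.branch (traceLast A) c'
  | _, random q _ _ next, A, c' => ∑ i, (q i : ℂ) • (next i).branch A c'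

/-- The probability that `Λ`, run on the state `ρ`, announces success. -/
def successProb {d : ℕ} [NeZero d] {m n : ℕ} (Λ : StabProtocol d m n) (ρ : Op d n) : ℝ :=
  (Matrix.trace (Λ.branch ρ true)).re

/-- The output state of `Λ`, run on the state `ρ`, conditioned on success (meaningful if the
success probability is positive). -/
def successState {d : ℕ} [NeZero d] {m n : ℕ} (Λ : StabProtocol d m n) (ρ : Op d n) : Op d m :=
  ((Λ.successProb ρ : ℂ))⁻¹ • Λ.branch ρ true

end StabProtocol

/-- The number of runs up to and including the first success, where run number `j + 1` succeeds
iff `x j = true` (meaningful if there is a success). -/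
def numRuns (x : ℕ → Bool) : ℕ := sInf {j | x j = true} + 1

end StabMagic

end

open StabMagic

namespace StabMagic

open scoped ComplexOrder
open Finset

/-! The quantity to follow is `wigNorm`, the ℓ¹-norm of the Wigner function, extended linearly to
all operators. It is multiplicative on tensor products, invariant under Cliffords (which permute the
phase points), at most `1` on stabilizer states, contracted by partial trace, and contracted by a
measurement even after summing over the unnormalized outcomes. Induction on the protocol
(`wigNorm_branch_add_le`) bounds success norm plus failure norm by the input norm.

The success branch is `p σ^{⊗m}`. Of the failure branch only the trace `1 - p` is known, but the
norm dominates the absolute trace. Hence `p ‖σ‖^m + (1 - p) ≤ ‖ρ‖^k`, and concavity of `log` gives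
`p m 𝓜(σ) ≤ k 𝓜(ρ)` (`successProb_mul_mana_le`). The number of runs is geometric with mean `p⁻¹`, so
dividing by `p` gives the claim.

Since the norm is defined for all operators, positivity of intermediate states is never needed. -/

/-! ### Product operators -/

/-- The product operator `M 0 ⊗ ⋯ ⊗ M (n - 1)`. -/
def prodOp {d n : ℕ} (M : Fin n → Matrix (ZMod d) (ZMod d) ℂ) : Op d n :=
  Matrix.of fun x y => ∏ i, M i (x i) (y i)

section Prod

variable {d n : ℕ} [NeZero d]

lemma prodOp_mul (M N : Fin n → Matrix (ZMod d) (ZMod d) ℂ) :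
    prodOp M * prodOp N = prodOp fun i => M i * N i := by
  ext x y
  simp only [prodOp, Matrix.mul_apply, Matrix.of_apply, ← Finset.prod_mul_distrib]
  exact (Fintype.prod_sum fun i c => M i (x i) c * N i c (y i)).symm

omit [NeZero d] in
lemma prodOp_conjTranspose (M : Fin n → Matrix (ZMod d) (ZMod d) ℂ) :
    (prodOp M).conjTranspose = prodOp fun i => (M i).conjTranspose := by
  ext x y
  simp [prodOp, Matrix.conjTranspose_apply]

omit [NeZero d] in
lemma prodOp_smul (c : Fin n → ℂ) (M : Fin n → Matrix (ZMod d) (ZMod d) ℂ) :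
    (prodOp fun i => c i • M i) = (∏ i, c i) • prodOp M := by
  ext x y
  simp [prodOp, Finset.prod_mul_distrib]

omit [NeZero d] in
lemma prodOp_sum {κ : Type*} [Fintype κ] (M : Fin n → κ → Matrix (ZMod d) (ZMod d) ℂ) :
    (prodOp fun i => ∑ k, M i k) = ∑ v : Fin n → κ, prodOp fun i => M i (v i) := by
  ext x y
  simp only [prodOp, Matrix.of_apply, Matrix.sum_apply]
  exact Fintype.prod_sum fun i k => M i k (x i) (y i)

omit [NeZero d] in
lemma prodOp_one : (prodOp fun _ => 1 : Op d n) = 1 := by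
  ext x y
  by_cases h : x = y
  · simp [prodOp, h, Matrix.one_apply]
  · obtain ⟨i, hi⟩ := Function.ne_iff.1 h
    rw [Matrix.one_apply_ne h]
    exact Finset.prod_eq_zero (mem_univ i) (Matrix.one_apply_ne hi)

lemma weyl_eq_prodOp (u : Fin n → ZMod d × ZMod d) : weyl u = prodOp fun i => weyl₁ (u i) := rfl

end Prod

lemma addChar_map_sum {A ι : Type*} [AddCommMonoid A] (ψ : AddChar A ℂ) (s : Finset ι)
    (f : ι → A) : ψ (∑ i ∈ s, f i) = ∏ i ∈ s, ψ (f i) := by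
  classical
  induction s using Finset.induction_on with
  | empty => simp
  | insert i s hi ih => rw [sum_insert hi, prod_insert hi, AddChar.map_add_eq_mul, ih]

/-! ### The Weyl relations -/

section Weyl

variable {d n : ℕ}

lemma shiftX_pow_apply [NeZero d] (k : ℕ) (x y : ZMod d) :
    (shiftX d ^ k) x y = if x = y + k then 1 else 0 := by
  induction k generalizing x with
  | zero => simp [Matrix.one_apply]
  | succ k ih =>
    rw [pow_succ', Matrix.mul_apply]
    rw [Finset.sum_eq_single (y + k)]
    · rw [ih]
      simp [shiftX, add_assoc]
    · intro z _ hz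
      rw [ih, if_neg hz, mul_zero]
    · simp

lemma weyl₁_apply [NeZero d] (a : ZMod d × ZMod d) (x y : ZMod d) :
    weyl₁ a x y =
      if x = y + a.2 then ZMod.stdAddChar (a.1 * x - a.1 * a.2 * 2⁻¹) else 0 := by
  rw [weyl₁, boostZ, Matrix.diagonal_pow, Matrix.smul_apply, Matrix.diagonal_mul,
    shiftX_pow_apply, ZMod.natCast_zmod_val]
  split_ifs
  · rw [Pi.pow_apply, ← AddChar.map_nsmul_eq_pow, nsmul_eq_mul, ZMod.natCast_zmod_val, mul_one,
      smul_eq_mul, ← AddChar.map_add_eq_mul]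
    congr 1
    ring
  · simp

/-- Half of the symplectic form on the one-qudit phase space. -/
def halfForm₁ (a b : ZMod d × ZMod d) : ZMod d := (a.1 * b.2 - b.1 * a.2) * 2⁻¹

/-- Half of the symplectic form on phase space. -/
def halfForm (u v : Fin n → ZMod d × ZMod d) : ZMod d := ∑ i, halfForm₁ (u i) (v i)

lemma halfForm_swap (u v : Fin n → ZMod d × ZMod d) : halfForm v u = -halfForm u v := by
  simp only [halfForm, halfForm₁, ← Finset.sum_neg_distrib]
  exact Finset.sum_congr rfl fun i _ => by ring

lemma halfForm_add_left (u u' v : Fin n → ZMod d × ZMod d) :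
    halfForm (u + u') v = halfForm u v + halfForm u' v := by
  simp only [halfForm, halfForm₁, ← Finset.sum_add_distrib]
  exact Finset.sum_congr rfl fun i _ => by simp; ring

lemma halfForm_add_right (u v v' : Fin n → ZMod d × ZMod d) :
    halfForm u (v + v') = halfForm u v + halfForm u v' := by
  rw [halfForm_swap, halfForm_add_left, halfForm_swap u v, halfForm_swap u v']
  ring

lemma two_ne_zero_zmod [Fact d.Prime] (hd : d ≠ 2) : (2 : ZMod d) ≠ 0 := by
  have := Ring.two_ne_zero (R := ZMod d)
  exact this (by rwa [ZMod.ringChar_zmod_n])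

lemma weyl₁_mul [Fact d.Prime] (hd : d ≠ 2) (a b : ZMod d × ZMod d) :
    weyl₁ a * weyl₁ b = (ZMod.stdAddChar (halfForm₁ a b) : ℂ) • weyl₁ (a + b) := by
  have h2 := two_ne_zero_zmod hd
  ext x y
  rw [Matrix.mul_apply, Finset.sum_eq_single (y + b.2)]
  · simp only [weyl₁_apply, Matrix.smul_apply, Prod.snd_add, Prod.fst_add, if_true, smul_eq_mul,
      add_assoc, add_comm a.2 b.2]
    split_ifs with h
    · rw [← AddChar.map_add_eq_mul, ← AddChar.map_add_eq_mul]
      congr 1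
      rw [h, halfForm₁]
      field_simp
      ring
    · simp
  · intro z _ hz
    simp [weyl₁_apply, hz]
  · simp

lemma weyl₁_conjTranspose [Fact d.Prime] (a : ZMod d × ZMod d) (hd : d ≠ 2) :
    (weyl₁ a).conjTranspose = weyl₁ (-a) := by
  have h2 := two_ne_zero_zmod hd
  ext x y
  rw [Matrix.conjTranspose_apply]
  simp only [weyl₁_apply, Prod.snd_neg, Prod.fst_neg, ← sub_eq_add_neg, eq_sub_iff_add_eq,
    eq_comm (a := y)]
  split_ifs with h
  · rw [← starRingEnd_apply, ← AddChar.map_neg_eq_conj]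
    congr 1
    rw [← h]
    field_simp
    ring
  · simp

lemma weyl₁_zero [NeZero d] : weyl₁ (0 : ZMod d × ZMod d) = 1 := by
  ext x y
  simp [weyl₁_apply, Matrix.one_apply]

lemma weyl_zero [NeZero d] : weyl (0 : Fin n → ZMod d × ZMod d) = 1 := by
  simp [weyl_eq_prodOp, weyl₁_zero, prodOp_one]

lemma weyl_mul [Fact d.Prime] (hd : d ≠ 2) (u v : Fin n → ZMod d × ZMod d) :
    weyl u * weyl v = (ZMod.stdAddChar (halfForm u v) : ℂ) • weyl (u + v) := by
  simp only [weyl_eq_prodOp, prodOp_mul, weyl₁_mul hd, prodOp_smul, halfForm,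
    addChar_map_sum, Pi.add_apply]

lemma weyl_conjTranspose [Fact d.Prime] (hd : d ≠ 2) (u : Fin n → ZMod d × ZMod d) :
    (weyl u).conjTranspose = weyl (-u) := by
  simp [weyl_eq_prodOp, prodOp_conjTranspose, weyl₁_conjTranspose _ hd]

lemma halfForm_self (u : Fin n → ZMod d × ZMod d) : halfForm u u = 0 := by
  simp [halfForm, halfForm₁]

lemma halfForm_neg_right (u v : Fin n → ZMod d × ZMod d) : halfForm u (-v) = -halfForm u v := by
  simp only [halfForm, halfForm₁, ← Finset.sum_neg_distrib]
  exact Finset.sum_congr rfl fun i _ => by simp; ring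

lemma weyl_conj [Fact d.Prime] (hd : d ≠ 2) (u v : Fin n → ZMod d × ZMod d) :
    weyl u * weyl v * (weyl u).conjTranspose =
      (ZMod.stdAddChar (2 * halfForm u v) : ℂ) • weyl v := by
  rw [weyl_conjTranspose hd, weyl_mul hd, Matrix.smul_mul, weyl_mul hd, smul_smul,
    ← AddChar.map_add_eq_mul]
  congr 2
  · rw [halfForm_neg_right, halfForm_add_left, halfForm_self, halfForm_swap u v]
    ring
  · abel

lemma weyl_mul_neg [Fact d.Prime] (hd : d ≠ 2) (u : Fin n → ZMod d × ZMod d) :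
    weyl u * weyl (-u) = 1 := by
  rw [weyl_mul hd, halfForm_neg_right, halfForm_self]
  simp [weyl_zero]

lemma weyl_ne_zero [Fact d.Prime] (hd : d ≠ 2) (u : Fin n → ZMod d × ZMod d) :
    weyl u ≠ 0 := fun h => by
  have := weyl_mul_neg hd u
  rw [h, zero_mul] at this
  exact zero_ne_one this

/-- The phase point operators are the symplectic Fourier transform of the Weyl operators. -/
lemma phasePoint_eq_sum [Fact d.Prime] (hd : d ≠ 2) (u : Fin n → ZMod d × ZMod d) :
    phasePoint u = ((d : ℂ) ^ n)⁻¹ •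
      ∑ v : Fin n → ZMod d × ZMod d, (ZMod.stdAddChar (2 * halfForm u v) : ℂ) • weyl v := by
  simp only [phasePoint, phasePointZero, Matrix.mul_smul, Matrix.smul_mul, Matrix.mul_sum,
    Matrix.sum_mul, weyl_conj hd]

/-- The one-qudit phase point operators. -/
noncomputable def pointOp [NeZero d] (a : ZMod d × ZMod d) : Matrix (ZMod d) (ZMod d) ℂ :=
  Matrix.of fun x y => if x + y = 2 * a.2 then ZMod.stdAddChar (a.1 * (x - y)) else 0

lemma sum_stdAddChar_mul [Fact d.Prime] (t : ZMod d) :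
    ∑ p : ZMod d, (ZMod.stdAddChar (p * t) : ℂ) = if t = 0 then (d : ℂ) else 0 := by
  rw [AddChar.sum_mulShift t (ZMod.isPrimitive_stdAddChar d)]
  simp [ZMod.card]

/-- Only the shift `x - y` contributes to the entry `(x, y)`; the remaining sum over momenta is
character orthogonality and forces `x + y = 2 * a.2`. The resulting explicit kernel reduces the
later Wigner computations to one qudit. -/
lemma sum_weyl₁ [Fact d.Prime] (hd : d ≠ 2) (a : ZMod d × ZMod d) :
    ∑ b, (ZMod.stdAddChar (2 * halfForm₁ a b) : ℂ) • weyl₁ b = (d : ℂ) • pointOp a := by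
  have h2 := two_ne_zero_zmod hd
  ext x y
  rw [Matrix.sum_apply, Fintype.sum_prod_type]
  simp only [Matrix.smul_apply, weyl₁_apply, pointOp, Matrix.of_apply, smul_eq_mul]
  calc _ = ∑ p : ZMod d, (ZMod.stdAddChar (a.1 * (x - y)) : ℂ) *
        ZMod.stdAddChar (p * ((x + y) * 2⁻¹ - a.2)) := by
        refine Finset.sum_congr rfl fun p _ => ?_
        rw [Finset.sum_eq_single (x - y)]
        · rw [if_pos (by ring), ← AddChar.map_add_eq_mul, ← AddChar.map_add_eq_mul]
          congr 1
          simp only [halfForm₁]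
          field_simp
          ring
        · intro q _ hq
          rw [if_neg (fun h => hq (by rw [h]; ring)), mul_zero]
        · simp
    _ = _ := by
        rw [← Finset.mul_sum, sum_stdAddChar_mul]
        have : (x + y) * 2⁻¹ - a.2 = 0 ↔ x + y = 2 * a.2 := by
          rw [sub_eq_zero, mul_inv_eq_iff_eq_mul₀ h2, mul_comm]
        simp only [this]
        split_ifs <;> ring

lemma phasePoint_eq_prodOp [Fact d.Prime] (hd : d ≠ 2) (u : Fin n → ZMod d × ZMod d) :
    phasePoint u = prodOp fun i => pointOp (u i) := by
  have hd0 : (d : ℂ) ≠ 0 := Nat.cast_ne_zero.2 (NeZero.ne d)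
  have h := prodOp_sum fun (i : Fin n) (b : ZMod d × ZMod d) =>
    (ZMod.stdAddChar (2 * halfForm₁ (u i) b) : ℂ) • weyl₁ b
  simp only [sum_weyl₁ hd, prodOp_smul] at h
  rw [phasePoint_eq_sum hd, inv_smul_eq_iff₀ (pow_ne_zero _ hd0)]
  simp only [Finset.prod_const, Finset.card_univ, Fintype.card_fin] at h
  rw [h]
  refine Finset.sum_congr rfl fun v _ => ?_
  rw [halfForm, Finset.mul_sum, addChar_map_sum, weyl_eq_prodOp]

lemma phasePoint_apply [Fact d.Prime] (hd : d ≠ 2) (u : Fin n → ZMod d × ZMod d)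
    (x y : Fin n → ZMod d) : phasePoint u x y = ∏ i, pointOp (u i) (x i) (y i) := by
  rw [phasePoint_eq_prodOp hd]
  rfl

end Weyl

/-! ### Clifford operators permute the phase point operators -/

lemma addChar_ne_zero {A : Type*} [AddGroup A] (ψ : AddChar A ℂ) (a : A) : ψ a ≠ 0 :=
  (AddChar.val_isUnit ψ a).ne_zero

section Clifford

variable {d n : ℕ}

lemma halfForm_single (u : Fin n → ZMod d × ZMod d) (i : Fin n) (b : ZMod d × ZMod d) :
    halfForm u (Pi.single i b) = halfForm₁ (u i) b := by
  rw [halfForm, Finset.sum_eq_single i]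
  · simp
  · intro j _ hj
    simp [hj, halfForm₁]
  · simp

variable [Fact d.Prime] (hd : d ≠ 2)
include hd

/-- Nondegeneracy of the symplectic form, tested on vectors supported at one site. -/
lemma eq_of_stdAddChar_halfForm {u u' : Fin n → ZMod d × ZMod d}
    (h : ∀ v, (ZMod.stdAddChar (2 * halfForm u v) : ℂ) = ZMod.stdAddChar (2 * halfForm u' v)) :
    u = u' := by
  have h2 := two_ne_zero_zmod hd
  have key (i : Fin n) (b : ZMod d × ZMod d) :
      2 * halfForm₁ (u i) b = 2 * halfForm₁ (u' i) b := by
    have := ZMod.injective_stdAddChar (h (Pi.single i b))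
    simpa only [halfForm_single] using this
  funext i
  have h1 := key i (0, 1)
  have h3 := key i (1, 0)
  simp only [halfForm₁] at h1 h3
  field_simp at h1 h3
  exact Prod.ext (by simpa using h1) (by simpa using h3)

/-- Every character of phase space is a symplectic character. -/
lemma exists_eq_stdAddChar_halfForm (χ : AddChar (Fin n → ZMod d × ZMod d) ℂ) :
    ∃ w, ∀ v, χ v = ZMod.stdAddChar (2 * halfForm w v) := by
  let φ : (Fin n → ZMod d × ZMod d) → AddChar (Fin n → ZMod d × ZMod d) ℂ := fun w =>
    { toFun := fun v => ZMod.stdAddChar (2 * halfForm w v)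
      map_zero_eq_one' := by simp [halfForm, halfForm₁]
      map_add_eq_mul' := fun v v' => by
        rw [halfForm_add_right, mul_add, AddChar.map_add_eq_mul] }
  -- Nondegeneracy gives injectivity; a finite abelian group has as many complex characters as
  -- elements.
  have hφ : Function.Bijective φ := by
    rw [Fintype.bijective_iff_injective_and_card]
    exact ⟨fun w w' h => eq_of_stdAddChar_halfForm hd fun v => DFunLike.congr_fun h v,
      AddChar.card_eq.symm⟩
  obtain ⟨w, rfl⟩ := hφ.surjective χ
  exact ⟨w, fun v => rfl⟩

/-- The commutation phases of an operator with all `weyl w` are unaffected by a scalar factor and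
determine the label. -/
lemma eq_of_smul_weyl_eq {a b : ℂ} (ha : a ≠ 0) {u v : Fin n → ZMod d × ZMod d}
    (h : a • weyl u = b • weyl v) : u = v := by
  refine eq_of_stdAddChar_halfForm hd fun w => ?_
  have comm (t : Fin n → ZMod d × ZMod d) :
      weyl t * weyl w = (ZMod.stdAddChar (2 * halfForm t w) : ℂ) • (weyl w * weyl t) := by
    rw [weyl_mul hd, weyl_mul hd, smul_smul, ← AddChar.map_add_eq_mul, add_comm t w,
      halfForm_swap t w]
    congr 2
    ring
  have e : a • (weyl u * weyl w) = b • (weyl v * weyl w) := by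
    rw [← Matrix.smul_mul, h, Matrix.smul_mul]
  rw [comm, comm, smul_comm, smul_comm b, ← Matrix.mul_smul _ a, ← Matrix.mul_smul _ b, ← h,
    ← sub_eq_zero, ← sub_smul, smul_eq_zero, sub_eq_zero] at e
  refine e.resolve_right fun e => ?_
  rw [Matrix.mul_smul, smul_eq_zero, weyl_mul hd, smul_eq_zero] at e
  rcases e with e | e | e
  · exact ha e
  · exact (addChar_ne_zero _ _) e
  · exact weyl_ne_zero hd _ e

/-- A Clifford operator acts on the Weyl operators by an additive bijection of phase space, up to
a character. -/
lemma IsClifford.exists_equiv {U : Op d n} (hU : IsClifford U) :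
    ∃ (S : (Fin n → ZMod d × ZMod d) ≃+ (Fin n → ZMod d × ZMod d))
      (χ : AddChar (Fin n → ZMod d × ZMod d) ℂ),
      ∀ u, U * weyl u * U.conjTranspose = χ u • weyl (S u) := by
  have h2 := two_ne_zero_zmod hd
  obtain ⟨hU1, hU2⟩ := hU
  have hUU : U.conjTranspose * U = 1 := Matrix.mem_unitaryGroup_iff'.1 hU1
  choose φ S hS using hU2
  obtain ⟨c, hc⟩ : ∃ c : (Fin n → ZMod d × ZMod d) → ℂ,
      c = fun u => Complex.exp (Complex.I * φ u) := ⟨_, rfl⟩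
  have hc0 (u) : c u ≠ 0 := by rw [hc]; exact Complex.exp_ne_zero _
  replace hS (u) : U * weyl u * U.conjTranspose = c u • weyl (S u) := by rw [hS, hc]
  have back (u) : weyl u = c u • (U.conjTranspose * weyl (S u) * U) := by
    rw [← Matrix.smul_mul, ← Matrix.mul_smul, ← hS]
    simp only [Matrix.mul_assoc, hUU, Matrix.mul_one]
    rw [← Matrix.mul_assoc, hUU, Matrix.one_mul]
  have inj : Function.Injective S := fun u v h => by
    refine eq_of_smul_weyl_eq hd (hc0 v) (b := c u) ?_
    rw [back u, back v, h, smul_comm]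
  -- Two evaluations of `U * (weyl u * weyl v) * U†`. Comparing labels makes `S` additive; comparing
  -- coefficients gives `coef`.
  have mul (u v) : (c u * c v * ZMod.stdAddChar (halfForm (S u) (S v))) • weyl (S u + S v) =
      (ZMod.stdAddChar (halfForm u v) * c (u + v)) • weyl (S (u + v)) := by
    rw [mul_smul, mul_smul (ZMod.stdAddChar _), ← weyl_mul hd, ← hS, mul_smul,
      ← Matrix.mul_smul _ (c v), ← Matrix.smul_mul (c u), ← hS, ← hS, ← Matrix.smul_mul,
      ← Matrix.mul_smul, ← weyl_mul hd]
    simp only [Matrix.mul_assoc]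
    rw [← Matrix.mul_assoc U.conjTranspose U, hUU, Matrix.one_mul]
  have hne (u v) : c u * c v * ZMod.stdAddChar (halfForm (S u) (S v)) ≠ 0 :=
    mul_ne_zero (mul_ne_zero (hc0 u) (hc0 v)) (addChar_ne_zero _ _)
  have add (u v) : S (u + v) = S u + S v := (eq_of_smul_weyl_eq hd (hne u v) (mul u v)).symm
  have coef (u v) : c u * c v * ZMod.stdAddChar (halfForm (S u) (S v)) =
      ZMod.stdAddChar (halfForm u v) * c (u + v) := by
    have := mul u v
    rw [add, ← sub_eq_zero, ← sub_smul, smul_eq_zero] at this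
    exact sub_eq_zero.1 (this.resolve_right (weyl_ne_zero hd _))
  -- Exchanging `u` and `v` in `coef` flips the sign of both forms but keeps the factors `c`, so
  -- these cancel; the factor `2` left over is invertible.
  have form (u v) : halfForm (S u) (S v) = halfForm u v := by
    have h1 := coef u v
    have h3 := coef v u
    rw [halfForm_swap (S u), halfForm_swap u, add_comm v u] at h3
    have h4 : (ZMod.stdAddChar (halfForm (S u) (S v)) * ZMod.stdAddChar (-halfForm u v) : ℂ) =
        ZMod.stdAddChar (-halfForm (S u) (S v)) * ZMod.stdAddChar (halfForm u v) := by
      refine mul_left_cancel₀ (mul_ne_zero (mul_ne_zero (hc0 u) (hc0 v)) (hc0 (u + v))) ?_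
      linear_combination (ZMod.stdAddChar (-halfForm u v) * c (u + v)) * h1 -
        (ZMod.stdAddChar (halfForm u v) * c (u + v)) * h3
    rw [← AddChar.map_add_eq_mul, ← AddChar.map_add_eq_mul] at h4
    have h5 := ZMod.injective_stdAddChar h4
    refine mul_left_cancel₀ h2 ?_
    linear_combination h5
  have cadd (u v) : c (u + v) = c u * c v := by
    have := coef u v
    rw [form, mul_comm (ZMod.stdAddChar _)] at this
    exact (mul_right_cancel₀ (addChar_ne_zero _ _) this).symm
  have c0 : c 0 = 1 := by
    have := cadd 0 0
    rw [add_zero] at this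
    exact (mul_left_cancel₀ (hc0 0) (by rw [mul_one]; exact this)).symm
  refine ⟨AddEquiv.ofBijective (AddMonoidHom.mk' S add) (Finite.injective_iff_bijective.1 inj),
    ⟨c, c0, cadd⟩, fun u => hS u⟩

/-- In the Fourier expansion of a phase point operator, `U` relabels `v` to `S v` and multiplies the
coefficient by `χ v`. The new coefficients again form a character, hence the symplectic character of
some new point. -/
lemma IsClifford.exists_perm {U : Op d n} (hU : IsClifford U) :
    ∃ f : Equiv.Perm (Fin n → ZMod d × ZMod d),
      ∀ u, U * phasePoint u * U.conjTranspose = phasePoint (f u) := by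
  obtain ⟨S, χ, hS⟩ := hU.exists_equiv hd
  have hex (w) : ∃ w', ∀ v, (ZMod.stdAddChar (2 * halfForm w' (S v)) : ℂ) =
      ZMod.stdAddChar (2 * halfForm w v) * χ v := by
    obtain ⟨w', hw'⟩ := exists_eq_stdAddChar_halfForm hd
      { toFun := fun v => (ZMod.stdAddChar (2 * halfForm w (S.symm v)) : ℂ) * χ (S.symm v)
        map_zero_eq_one' := by simp [halfForm, halfForm₁]
        map_add_eq_mul' := fun v v' => by
          rw [map_add, halfForm_add_right, mul_add, AddChar.map_add_eq_mul,
            AddChar.map_add_eq_mul]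
          ring }
    exact ⟨w', fun v => by rw [← hw']; simp⟩
  choose f hf using hex
  have inj : Function.Injective f := fun w w' h => eq_of_stdAddChar_halfForm hd fun v =>
    mul_right_cancel₀ (addChar_ne_zero χ v) (by rw [← hf, ← hf, h])
  refine ⟨Equiv.ofBijective f (Finite.injective_iff_bijective.1 inj), fun u => ?_⟩
  rw [Equiv.ofBijective_apply, phasePoint_eq_sum hd, phasePoint_eq_sum hd, Matrix.mul_smul,
    Matrix.smul_mul, Matrix.mul_sum, Matrix.sum_mul,
    ← Equiv.sum_comp S.toEquiv (fun v => (ZMod.stdAddChar (2 * halfForm (f u) v) : ℂ) • weyl v)]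
  congr 1
  refine Finset.sum_congr rfl fun v _ => ?_
  rw [Matrix.mul_smul, Matrix.smul_mul, hS, smul_smul]
  exact congrArg (· • weyl (S v)) (hf u v).symm

end Clifford

/-! ### The complex Wigner function and its norm -/

section WigNorm

variable {d n : ℕ} [NeZero d]

/-- The Wigner function of an arbitrary operator. -/
noncomputable def wig (A : Op d n) (u : Fin n → ZMod d × ZMod d) : ℂ :=
  ((d : ℂ) ^ n)⁻¹ * (phasePoint u * A).trace

/-- The `ℓ¹`-norm of the Wigner function. -/
noncomputable def wigNorm (A : Op d n) : ℝ := ∑ u, ‖wig A u‖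

lemma wig_add (A B : Op d n) (u) : wig (A + B) u = wig A u + wig B u := by
  simp [wig, mul_add]

lemma wig_smul (c : ℂ) (A : Op d n) (u) : wig (c • A) u = c * wig A u := by
  simp only [wig, Matrix.mul_smul, Matrix.trace_smul, smul_eq_mul]
  ring

lemma wigNorm_nonneg (A : Op d n) : 0 ≤ wigNorm A := Finset.sum_nonneg fun _ _ => norm_nonneg _

lemma wigNorm_add_le (A B : Op d n) : wigNorm (A + B) ≤ wigNorm A + wigNorm B := by
  simp only [wigNorm, wig_add, ← Finset.sum_add_distrib]
  exact Finset.sum_le_sum fun _ _ => norm_add_le _ _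

lemma wigNorm_smul (c : ℂ) (A : Op d n) : wigNorm (c • A) = ‖c‖ * wigNorm A := by
  simp only [wigNorm, wig_smul, norm_mul, Finset.mul_sum]

lemma wigNorm_zero : wigNorm (0 : Op d n) = 0 := by
  simp [wigNorm, wig]

lemma wigNorm_sum_le {ι : Type*} (s : Finset ι) (A : ι → Op d n) :
    wigNorm (∑ i ∈ s, A i) ≤ ∑ i ∈ s, wigNorm (A i) :=
  Finset.le_sum_of_subadditive _ wigNorm_zero.le wigNorm_add_le s A

end WigNorm

lemma IsClifford.wigNorm_conj {d n : ℕ} [Fact d.Prime] (hd : d ≠ 2) {U : Op d n}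
    (hU : IsClifford U) (A : Op d n) : wigNorm (U * A * U.conjTranspose) = wigNorm A := by
  obtain ⟨f, hf⟩ := hU.exists_perm hd
  have hUU : U.conjTranspose * U = 1 := Matrix.mem_unitaryGroup_iff'.1 hU.1
  rw [wigNorm, ← Equiv.sum_comp f]
  refine Finset.sum_congr rfl fun u _ => ?_
  have : phasePoint (f u) * (U * A * U.conjTranspose) =
      U * (phasePoint u * A) * U.conjTranspose := by
    rw [← hf]
    simp only [Matrix.mul_assoc]
    rw [← Matrix.mul_assoc U.conjTranspose U, hUU, Matrix.one_mul]
  rw [wig, this, Matrix.trace_mul_comm, ← Matrix.mul_assoc, hUU, Matrix.one_mul, wig]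

lemma IsClifford.trace_conj {d n : ℕ} [NeZero d] {U : Op d n}
    (hU : IsClifford U) (A : Op d n) : (U * A * U.conjTranspose).trace = A.trace := by
  have hUU : U.conjTranspose * U = 1 := Matrix.mem_unitaryGroup_iff'.1 hU.1
  rw [Matrix.trace_mul_comm, ← Matrix.mul_assoc, hUU, Matrix.one_mul]

/-! ### Wigner functions of products, stabilizer states, measured and traced out operators -/

section Reindex

lemma sum_snoc {κ M : Type*} [Fintype κ] [AddCommMonoid M] {n : ℕ}
    (f : (Fin (n + 1) → κ) → M) :
    ∑ x, f x = ∑ x : Fin n → κ, ∑ c : κ, f (Fin.snoc (α := fun _ => κ) x c) := by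
  rw [← Equiv.sum_comp (Fin.snocEquiv fun _ : Fin (n + 1) => κ), Fintype.sum_prod_type_right]
  rfl

lemma sum_append {κ M : Type*} [Fintype κ] [AddCommMonoid M] {n r : ℕ}
    (f : (Fin (n + r) → κ) → M) :
    ∑ x, f x = ∑ x : Fin n → κ, ∑ y : Fin r → κ, f (Fin.append x y) := by
  rw [← Equiv.sum_comp (Fin.appendEquiv n r), Fintype.sum_prod_type]
  rfl

/-- Concatenation of `k` strings of length `n`. -/
def joinEquiv (k n : ℕ) (κ : Type*) : (Fin k → Fin n → κ) ≃ (Fin (k * n) → κ) :=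
  (Equiv.curry (Fin k) (Fin n) κ).symm.trans (finProdFinEquiv.arrowCongr (Equiv.refl κ))

lemma joinEquiv_apply {k n : ℕ} {κ : Type*} (X : Fin k → Fin n → κ) (i : Fin k) (j : Fin n) :
    joinEquiv k n κ X (finProdFinEquiv (i, j)) = X i j := by
  simp [joinEquiv]

lemma prod_finProdFin {k n : ℕ} {M : Type*} [CommMonoid M] (f : Fin (k * n) → M) :
    ∏ l, f l = ∏ i : Fin k, ∏ j : Fin n, f (finProdFinEquiv (i, j)) := by
  rw [← Equiv.prod_comp finProdFinEquiv, Fintype.prod_prod_type]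

end Reindex

section Wig

variable {d n r : ℕ} [Fact d.Prime] (hd : d ≠ 2)

omit hd in
lemma wig_eq_sum (A : Op d n) (u) :
    wig A u = ((d : ℂ) ^ n)⁻¹ * ∑ x, ∑ y, phasePoint u x y * A y x := by
  simp [wig, Matrix.trace, Matrix.mul_apply]

include hd

lemma phasePoint_append (u : Fin n → ZMod d × ZMod d) (v : Fin r → ZMod d × ZMod d)
    (x y : Fin n → ZMod d) (x' y' : Fin r → ZMod d) :
    phasePoint (Fin.append u v) (Fin.append x x') (Fin.append y y') =
      phasePoint u x y * phasePoint v x' y' := by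
  simp [phasePoint_apply hd, Fin.prod_univ_add]

lemma wig_tensor (A : Op d n) (B : Op d r) (u : Fin n → ZMod d × ZMod d)
    (v : Fin r → ZMod d × ZMod d) : wig (tensor A B) (Fin.append u v) = wig A u * wig B v := by
  simp only [wig_eq_sum, sum_append, phasePoint_append hd, tensor, Matrix.of_apply,
    Fin.append_left, Fin.append_right]
  rw [pow_add, mul_inv, mul_mul_mul_comm, Finset.sum_mul_sum]
  congr 1
  refine Finset.sum_congr rfl fun x _ => Finset.sum_congr rfl fun x' _ => ?_
  rw [Finset.sum_mul_sum]
  exact Finset.sum_congr rfl fun y _ => Finset.sum_congr rfl fun y' _ => by ring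

lemma wigNorm_tensor (A : Op d n) (B : Op d r) :
    wigNorm (tensor A B) = wigNorm A * wigNorm B := by
  simp only [wigNorm, sum_append, wig_tensor hd, norm_mul, Finset.sum_mul_sum]

lemma phasePoint_join {k : ℕ} (u : Fin k → Fin n → ZMod d × ZMod d)
    (x y : Fin k → Fin n → ZMod d) :
    phasePoint (joinEquiv k n _ u) (joinEquiv k n _ x) (joinEquiv k n _ y) =
      ∏ i, phasePoint (u i) (x i) (y i) := by
  simp only [phasePoint_apply hd, prod_finProdFin, joinEquiv_apply]

lemma wig_tensorPow (A : Op d n) (k : ℕ) (u : Fin k → Fin n → ZMod d × ZMod d) :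
    wig (tensorPow A k) (joinEquiv k n _ u) = ∏ i, wig A (u i) := by
  simp only [wig_eq_sum, Finset.prod_mul_distrib, Fintype.prod_sum]
  congr 1
  · simp [← pow_mul, mul_comm]
  · rw [← Equiv.sum_comp (joinEquiv k n (ZMod d))]
    refine Finset.sum_congr rfl fun x _ => ?_
    rw [← Equiv.sum_comp (joinEquiv k n (ZMod d))]
    refine Finset.sum_congr rfl fun y _ => ?_
    rw [phasePoint_join hd, ← Finset.prod_mul_distrib]
    simp [tensorPow, joinEquiv_apply, Finset.prod_mul_distrib]

lemma wigNorm_tensorPow (A : Op d n) (k : ℕ) : wigNorm (tensorPow A k) = wigNorm A ^ k := by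
  rw [wigNorm, ← Equiv.sum_comp (joinEquiv k n _)]
  simp only [wig_tensorPow hd, norm_prod]
  rw [← Fintype.prod_sum fun (_ : Fin k) u => ‖wig A u‖]
  simp [wigNorm]

/-- The marginal property: summing over momentum at fixed position `q` gives `d` times the projector
onto `|q⟩`. -/
lemma sum_pointOp_fst (q s t : ZMod d) :
    ∑ p, pointOp (p, q) s t = if s = q ∧ t = q then (d : ℂ) else 0 := by
  have h2 := two_ne_zero_zmod hd
  simp only [pointOp, Matrix.of_apply]
  by_cases h : s + t = 2 * q
  · simp only [h, if_true, sum_stdAddChar_mul]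
    refine if_congr ⟨fun h' => ?_, fun h' => ?_⟩ rfl rfl
    · obtain rfl := sub_eq_zero.1 h'
      rw [← two_mul] at h
      exact ⟨mul_left_cancel₀ h2 h, mul_left_cancel₀ h2 h⟩
    · rw [h'.1, h'.2, sub_self]
  · rw [if_neg]
    · simp [h]
    · rintro ⟨rfl, rfl⟩
      exact h (two_mul _).symm

lemma sum_pointOp : ∑ a, pointOp a = (d : ℂ) • (1 : Matrix (ZMod d) (ZMod d) ℂ) := by
  ext s t
  rw [Matrix.sum_apply, Fintype.sum_prod_type_right]
  simp only [sum_pointOp_fst hd, Matrix.smul_apply, Matrix.one_apply, smul_eq_mul]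
  rw [Finset.sum_eq_single s]
  · simp [eq_comm]
  · intro q _ hq
    rw [if_neg fun h => hq h.1.symm]
  · simp

lemma sum_wig (A : Op d n) : ∑ u, wig A u = A.trace := by
  have hd0 : (d : ℂ) ≠ 0 := Nat.cast_ne_zero.2 (NeZero.ne d)
  simp only [wig, ← Finset.mul_sum, ← Matrix.trace_sum, ← Matrix.sum_mul]
  have : ∑ u : Fin n → ZMod d × ZMod d, phasePoint u = ((d : ℂ) ^ n) • 1 := by
    simp only [phasePoint_eq_prodOp hd]
    rw [← prodOp_sum fun (_ : Fin n) a => pointOp a]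
    simp [sum_pointOp hd, prodOp_smul, prodOp_one]
  rw [this, Matrix.smul_mul, Matrix.one_mul, Matrix.trace_smul, smul_eq_mul, ← mul_assoc,
    inv_mul_cancel₀ (pow_ne_zero _ hd0), one_mul]

lemma norm_trace_le_wigNorm (A : Op d n) : ‖A.trace‖ ≤ wigNorm A := by
  rw [← sum_wig hd]
  exact norm_sum_le _ _

/-- The trace is the total sum of the Wigner function, so it inherits multiplicativity. -/
lemma trace_tensor (A : Op d n) (B : Op d r) : (tensor A B).trace = A.trace * B.trace := by
  simp only [← sum_wig hd, sum_append, wig_tensor hd, Finset.sum_mul_sum]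

lemma trace_tensorPow (A : Op d n) (k : ℕ) : (tensorPow A k).trace = A.trace ^ k := by
  rw [← sum_wig hd, ← Equiv.sum_comp (joinEquiv k n _)]
  simp only [wig_tensorPow hd]
  rw [← Fintype.prod_sum fun (_ : Fin k) u => wig A u]
  simp [sum_wig hd]

/-- The Wigner function is uniform, of modulus `d⁻ⁿ`, on the `dⁿ` phase points with all positions
zero, and vanishes elsewhere. -/
lemma wigNorm_zeroState : wigNorm (zeroState d n) = 1 := by
  have h2 := two_ne_zero_zmod hd
  have hd0 : (d : ℝ) ≠ 0 := Nat.cast_ne_zero.2 (NeZero.ne d)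
  have hw (u) : ‖wig (zeroState d n) u‖ = ((d : ℝ) ^ n)⁻¹ * ∏ i, ‖pointOp (u i) 0 0‖ := by
    have : (phasePoint u * zeroState d n).trace = phasePoint u 0 0 := by
      simp [zeroState, Matrix.trace_mul_single]
    rw [wig, this, phasePoint_apply hd]
    simp
  simp only [wigNorm, hw, ← Finset.mul_sum]
  rw [← Fintype.prod_sum fun (_ : Fin n) a => ‖pointOp (d := d) a 0 0‖, Fintype.sum_prod_type]
  have (p q : ZMod d) : ‖pointOp (p, q) 0 0‖ = if q = 0 then 1 else 0 := by
    simp only [pointOp, Matrix.of_apply, add_zero, sub_zero, mul_zero, AddChar.map_zero_eq_one,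
      eq_comm (a := (0 : ZMod d)), mul_eq_zero, h2, false_or]
    split_ifs <;> simp
  simp [this, ZMod.card, inv_mul_cancel₀ (pow_ne_zero n hd0)]

lemma wigNorm_le_one_and_trace_of_mem_stab {S : Op d n} (hS : S ∈ stab d n) :
    wigNorm S ≤ 1 ∧ S.trace = 1 := by
  refine convexHull_min (t := {S : Op d n | wigNorm S ≤ 1 ∧ S.trace = 1}) ?_ ?_ hS
  · rintro _ ⟨U, hU, rfl⟩
    refine ⟨?_, ?_⟩
    · rw [hU.wigNorm_conj hd, wigNorm_zeroState hd]
    · rw [hU.trace_conj, zeroState, Matrix.trace_single_eq_same]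
  · rintro A ⟨hA, hA'⟩ B ⟨hB, hB'⟩ s t hs ht hst
    have hsc (c : ℝ) (M : Op d n) : c • M = (c : ℂ) • M := by
      ext; simp
    refine ⟨?_, ?_⟩
    · rw [hsc, hsc]
      refine (wigNorm_add_le _ _).trans ?_
      rw [wigNorm_smul, wigNorm_smul, Complex.norm_real, Complex.norm_real,
        Real.norm_of_nonneg hs, Real.norm_of_nonneg ht]
      nlinarith
    · rw [hsc, hsc, Matrix.trace_add, Matrix.trace_smul, Matrix.trace_smul, hA', hB']
      simp only [smul_eq_mul, mul_one]
      exact_mod_cast hst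

lemma phasePoint_snoc (u : Fin n → ZMod d × ZMod d) (c : ZMod d × ZMod d)
    (x y : Fin n → ZMod d) (s t : ZMod d) :
    phasePoint (Fin.snoc (α := fun _ => ZMod d × ZMod d) u c : Fin (n + 1) → _)
      (Fin.snoc (α := fun _ => ZMod d) x s) (Fin.snoc (α := fun _ => ZMod d) y t) =
      phasePoint u x y * pointOp c s t := by
  simp [phasePoint_apply hd, Fin.prod_univ_castSucc]

/-- The one-qudit phase point operators sum to `d • 1`, so tracing out a qudit is taking a marginal.
-/
lemma wig_traceLast (A : Op d (n + 1)) (u : Fin n → ZMod d × ZMod d) :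
    wig (traceLast A) u = ∑ c, wig A (Fin.snoc (α := fun _ => ZMod d × ZMod d) u c) := by
  have hd0 : (d : ℂ) ≠ 0 := Nat.cast_ne_zero.2 (NeZero.ne d)
  have hsum (s t : ZMod d) : ∑ c, pointOp c s t = if s = t then (d : ℂ) else 0 := by
    rw [← Matrix.sum_apply, sum_pointOp hd]
    simp [Matrix.one_apply]
  have hK (x y : Fin n → ZMod d) (s t : ZMod d) :
      (∑ c, phasePoint (Fin.snoc (α := fun _ => ZMod d × ZMod d) u c : Fin (n + 1) → _))
        (Fin.snoc (α := fun _ => ZMod d) x s) (Fin.snoc (α := fun _ => ZMod d) y t) =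
      d * if s = t then phasePoint u x y else 0 := by
    rw [Matrix.sum_apply]
    simp only [phasePoint_snoc hd, ← Finset.mul_sum, hsum]
    split_ifs <;> ring
  have hR : ∑ c, wig A (Fin.snoc (α := fun _ => ZMod d × ZMod d) u c) =
      ((d : ℂ) ^ (n + 1))⁻¹ * ((∑ c, phasePoint
        (Fin.snoc (α := fun _ => ZMod d × ZMod d) u c : Fin (n + 1) → _)) * A).trace := by
    simp only [wig, ← Finset.mul_sum, Matrix.sum_mul, Matrix.trace_sum]
  rw [hR, wig_eq_sum]
  simp only [Matrix.trace, Matrix.diag_apply, Matrix.mul_apply, sum_snoc, hK, traceLast,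
    Matrix.of_apply, mul_assoc, ← Finset.mul_sum, ite_mul, zero_mul, Finset.sum_ite_eq,
    Finset.mem_univ, if_true]
  rw [pow_succ, mul_inv, mul_assoc, inv_mul_cancel_left₀ hd0]
  congr 1
  refine Finset.sum_congr rfl fun x _ => ?_
  rw [Finset.sum_comm]
  exact Finset.sum_congr rfl fun y _ => Finset.mul_sum _ _ _

lemma wigNorm_traceLast_le (A : Op d (n + 1)) : wigNorm (traceLast A) ≤ wigNorm A := by
  simp only [wigNorm, sum_snoc, wig_traceLast hd]
  exact Finset.sum_le_sum fun _ _ => norm_sum_le _ _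

omit hd in
lemma trace_traceLast (A : Op d (n + 1)) : (traceLast A).trace = A.trace := by
  simp [traceLast, Matrix.trace, sum_snoc]

/-- On the last qudit, only the `(i, i)` entry of `pointOp c` survives: it is `1` if `c.2 = i` and
`0` otherwise. The projector left over is rewritten by `sum_pointOp_fst`. -/
lemma lastProj_mul_phasePoint_mul (i : ZMod d) (u : Fin n → ZMod d × ZMod d)
    (c : ZMod d × ZMod d) :
    lastProj i * phasePoint (Fin.snoc (α := fun _ => ZMod d × ZMod d) u c : Fin (n + 1) → _) *
      lastProj i = (if c.2 = i then (d : ℂ)⁻¹ else 0) •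
        ∑ p, phasePoint (Fin.snoc (α := fun _ => ZMod d × ZMod d) u (p, i) : Fin (n + 1) → _) := by
  have h2 := two_ne_zero_zmod hd
  have hd0 : (d : ℂ) ≠ 0 := Nat.cast_ne_zero.2 (NeZero.ne d)
  ext x y
  rw [← Fin.snoc_init_self x, ← Fin.snoc_init_self y, lastProj, Matrix.mul_diagonal,
    Matrix.diagonal_mul, Matrix.smul_apply, Matrix.sum_apply]
  simp only [phasePoint_snoc hd, Fin.snoc_last, ← Finset.mul_sum, sum_pointOp_fst hd]
  by_cases hx : x (Fin.last n) = i
  · by_cases hy : y (Fin.last n) = i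
    · by_cases hc : c.2 = i
      · simp [hx, hy, hc, pointOp, two_mul, hd0, mul_comm (phasePoint u _ _)]
      · have hc' : ¬i + i = 2 * c.2 := fun h =>
          hc (mul_left_cancel₀ h2 ((two_mul i).trans h)).symm
        simp [hx, hy, hc, hc', pointOp]
    · simp [hy]
  · simp [hx]

lemma wig_measure (A : Op d (n + 1)) (i : ZMod d) (u : Fin n → ZMod d × ZMod d)
    (c : ZMod d × ZMod d) :
    wig (lastProj i * A * lastProj i) (Fin.snoc (α := fun _ => ZMod d × ZMod d) u c) =
      (if c.2 = i then (d : ℂ)⁻¹ else 0) *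
        ∑ p, wig A (Fin.snoc (α := fun _ => ZMod d × ZMod d) u (p, i)) := by
  rw [wig, ← Matrix.mul_assoc, Matrix.trace_mul_comm, ← Matrix.mul_assoc, ← Matrix.mul_assoc,
    lastProj_mul_phasePoint_mul hd]
  simp only [wig, Matrix.smul_mul, Matrix.trace_smul, Matrix.sum_mul, Matrix.trace_sum,
    ← Finset.mul_sum, smul_eq_mul]
  ring

/-- Outcome `i` averages the Wigner function along the line of position `i` and erases it elsewhere.
Averaging contracts the ℓ¹-norm, and distinct outcomes use disjoint lines. -/
lemma sum_wigNorm_measure_le (A : Op d (n + 1)) :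
    ∑ i, wigNorm (lastProj i * A * lastProj i) ≤ wigNorm A := by
  have hd0 : (d : ℝ) ≠ 0 := Nat.cast_ne_zero.2 (NeZero.ne d)
  simp only [wigNorm, sum_snoc]
  rw [Finset.sum_comm]
  refine Finset.sum_le_sum fun u _ => ?_
  rw [Fintype.sum_prod_type_right]
  refine Finset.sum_le_sum fun i _ => ?_
  rw [Fintype.sum_prod_type_right, Finset.sum_eq_single i]
  · simp only [wig_measure hd, if_true, norm_mul, Finset.sum_const, Finset.card_univ, ZMod.card,
      nsmul_eq_mul, norm_inv, Complex.norm_natCast, ← mul_assoc, mul_inv_cancel₀ hd0, one_mul]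
    exact norm_sum_le _ _
  · intro q _ hq
    simp [wig_measure hd, hq]
  · simp

omit hd in
lemma sum_trace_measure (A : Op d (n + 1)) :
    ∑ i, (lastProj i * A * lastProj i).trace = A.trace := by
  simp only [Matrix.trace, lastProj, Matrix.mul_diagonal, Matrix.diagonal_mul, Matrix.diag_apply]
  rw [Finset.sum_comm]
  refine Finset.sum_congr rfl fun x _ => ?_
  rw [Finset.sum_eq_single (x (Fin.last n))] <;> simp +contextual [eq_comm]

end Wig

/-! ### Protocols do not increase the Wigner norm on average -/

namespace StabProtocol

variable {d m : ℕ} [Fact d.Prime]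

/-- Branches are unnormalized, so outcome probabilities are already contained in the norms. Both
announcements are kept so that the failure branch can later contribute its `1 - p`. -/
lemma wigNorm_branch_add_le (hd : d ≠ 2) {n : ℕ} (Λ : StabProtocol d m n) (A : Op d n) :
    wigNorm (Λ.branch A true) + wigNorm (Λ.branch A false) ≤ wigNorm A := by
  induction Λ with
  | halt c => cases c <;> simp [branch, wigNorm_zero]
  | clifford U hU next ih =>
    rw [← hU.wigNorm_conj hd A]
    exact ih _
  | adjoin S hS next ih =>
    refine (ih _).trans ?_
    rw [wigNorm_tensor hd]
    exact mul_le_of_le_one_right (wigNorm_nonneg A) (wigNorm_le_one_and_trace_of_mem_stab hd hS).1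
  | measure next ih =>
    refine (add_le_add (wigNorm_sum_le _ _) (wigNorm_sum_le _ _)).trans ?_
    rw [← Finset.sum_add_distrib]
    exact (Finset.sum_le_sum fun i _ => ih i _).trans (sum_wigNorm_measure_le hd A)
  | discard next ih => exact (ih _).trans (wigNorm_traceLast_le hd A)
  | random q hq hsum next ih =>
    refine (add_le_add (wigNorm_sum_le _ _) (wigNorm_sum_le _ _)).trans ?_
    rw [← Finset.sum_add_distrib, ← one_mul (wigNorm A), ← hsum, Finset.sum_mul]
    refine Finset.sum_le_sum fun i _ => ?_
    rw [wigNorm_smul, wigNorm_smul, Complex.norm_real, Real.norm_of_nonneg (hq i), ← mul_add]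
    exact mul_le_mul_of_nonneg_left (ih i A) (hq i)

lemma trace_branch_add (hd : d ≠ 2) {n : ℕ} (Λ : StabProtocol d m n) (A : Op d n) :
    (Λ.branch A true).trace + (Λ.branch A false).trace = A.trace := by
  induction Λ with
  | halt c => cases c <;> simp [branch]
  | clifford U hU next ih =>
    rw [← hU.trace_conj A]
    exact ih _
  | adjoin S hS next ih =>
    refine (ih _).trans ?_
    rw [trace_tensor hd, (wigNorm_le_one_and_trace_of_mem_stab hd hS).2, mul_one]
  | measure next ih =>
    simp only [branch, Matrix.trace_sum, ← Finset.sum_add_distrib, ih, sum_trace_measure]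
  | discard next ih => exact (ih _).trans (trace_traceLast A)
  | random q hq hsum next ih =>
    simp only [branch, Matrix.trace_sum, Matrix.trace_smul, ← Finset.sum_add_distrib, ← smul_add,
      ih, ← Finset.sum_smul]
    rw [← Complex.ofReal_sum, hsum, Complex.ofReal_one, one_smul]

end StabProtocol

/-! ### The mana -/

section Mana

variable {d n : ℕ} [Fact d.Prime] (hd : d ≠ 2)
include hd

/-- Needed so that `wig` is real on states and `mana` is the logarithm of `wigNorm`. -/
lemma phasePoint_isHermitian (u : Fin n → ZMod d × ZMod d) : (phasePoint u).IsHermitian := by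
  ext x y
  simp only [Matrix.conjTranspose_apply, phasePoint_apply hd, ← starRingEnd_apply, map_prod]
  refine Finset.prod_congr rfl fun i _ => ?_
  simp only [pointOp, Matrix.of_apply, add_comm (y i)]
  split_ifs
  · rw [← AddChar.map_neg_eq_conj]
    congr 1
    ring
  · simp

lemma norm_wig_of_isHermitian {A : Op d n} (hA : A.IsHermitian) (u) :
    ‖wig A u‖ = |wigner A u| := by
  have him : (phasePoint u * A).trace.im = 0 := by
    rw [← Complex.conj_eq_iff_im, starRingEnd_apply, ← Matrix.trace_conjTranspose,
      Matrix.conjTranspose_mul, hA.eq, (phasePoint_isHermitian hd u).eq, Matrix.trace_mul_comm]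
  have : wig A u = wigner A u := by
    rw [wig, wigner, ← Complex.re_add_im (Matrix.trace _), him]
    simp
  rw [this, Complex.norm_real, Real.norm_eq_abs]

lemma mana_eq_log_wigNorm {A : Op d n} (hA : IsState A) : mana A = Real.log (wigNorm A) := by
  simp only [mana, wigNorm, norm_wig_of_isHermitian hd hA.1.isHermitian]

lemma one_le_wigNorm {A : Op d n} (hA : IsState A) : 1 ≤ wigNorm A := by
  have := norm_trace_le_wigNorm hd A
  rwa [hA.2, norm_one] at this

end Mana

/-- A protocol that succeeds with probability `p` increases the mana at most by a factor `p⁻¹`. -/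
lemma StabProtocol.successProb_mul_mana_le {d : ℕ} [Fact d.Prime] (hd : d ≠ 2) {a b k m : ℕ}
    {ρ : Op d a} (hρ : IsState ρ) {σ : Op d b} (hσ : IsState σ)
    (Λ : StabProtocol d (m * b) (k * a)) (hpos : 0 < Λ.successProb (tensorPow ρ k))
    (hle : Λ.successProb (tensorPow ρ k) ≤ 1)
    (hΛ : Λ.successState (tensorPow ρ k) = tensorPow σ m) :
    Λ.successProb (tensorPow ρ k) * (m * mana σ) ≤ k * mana ρ := by
  have hp : (Λ.successProb (tensorPow ρ k) : ℂ) ≠ 0 := Complex.ofReal_ne_zero.2 hpos.ne'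
  have htrue : Λ.branch (tensorPow ρ k) true =
      (Λ.successProb (tensorPow ρ k) : ℂ) • tensorPow σ m := by
    rw [← hΛ, successState, smul_inv_smul₀ hp]
  have hnorm := Λ.wigNorm_branch_add_le hd (tensorPow ρ k)
  have htr := Λ.trace_branch_add hd (tensorPow ρ k)
  generalize Λ.successProb (tensorPow ρ k) = p at *
  rw [htrue, Matrix.trace_smul, trace_tensorPow hd, trace_tensorPow hd, hσ.2, hρ.2, one_pow,
    one_pow, smul_eq_mul, mul_one, ← eq_sub_iff_add_eq'] at htr
  have hfalse := norm_trace_le_wigNorm hd (Λ.branch (tensorPow ρ k) false)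
  rw [htr, ← Complex.ofReal_one, ← Complex.ofReal_sub, Complex.norm_real,
    Real.norm_of_nonneg (sub_nonneg.2 hle)] at hfalse
  rw [htrue, wigNorm_smul, Complex.norm_real, Real.norm_of_nonneg hpos.le, wigNorm_tensorPow hd,
    wigNorm_tensorPow hd] at hnorm
  have hs := one_le_wigNorm hd hσ
  have hsm : 0 < wigNorm σ ^ m := by positivity
  rw [mana_eq_log_wigNorm hd hσ, mana_eq_log_wigNorm hd hρ, ← Real.log_pow, ← Real.log_pow]
  -- Jensen at `wigNorm σ ^ m` and `1` with weights `p` and `1 - p`; the second term vanishes as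
  -- `log 1 = 0`.
  have hconc := strictConcaveOn_log_Ioi.concaveOn.2 (Set.mem_Ioi.2 hsm)
    (Set.mem_Ioi.2 one_pos) hpos.le (sub_nonneg.2 hle) (add_sub_cancel _ _)
  simp only [smul_eq_mul, Real.log_one, mul_zero, add_zero, mul_one] at hconc
  refine hconc.trans (Real.log_le_log ?_ (by linarith))
  nlinarith [mul_pos hpos hsm]

/-! ### The number of runs up to the first success -/

section Geometric

variable {Ω : Type*} [MeasurableSpace Ω] {P : Measure Ω} [IsProbabilityMeasure P]
  {X : ℕ → Ω → Bool}

lemma measure_forall_lt_eq_false (hX : ∀ j, Measurable (X j)) (hindep : iIndepFun X P) {p : ℝ}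
    (hp0 : 0 ≤ p) (hlaw : ∀ j, P {ω | X j ω = true} = ENNReal.ofReal p) (j : ℕ) :
    P {ω | ∀ i < j, X i ω = false} = ENNReal.ofReal (1 - p) ^ j := by
  have hfalse (i : ℕ) : P (X i ⁻¹' {false}) = ENNReal.ofReal (1 - p) := by
    have : X i ⁻¹' {false} = {ω | X i ω = true}ᶜ := by ext; simp
    have hm : MeasurableSet {ω | X i ω = true} := hX i (measurableSet_singleton true)
    rw [this, prob_compl_eq_one_sub hm, hlaw,
      ENNReal.ofReal_sub _ hp0, ENNReal.ofReal_one]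
  have h := hindep.measure_inter_preimage_eq_mul (Finset.range j) (sets := fun _ => {false})
    fun _ _ => measurableSet_singleton _
  simp only [hfalse, Finset.prod_const, Finset.card_range] at h
  rw [← h]
  congr 1
  ext ω
  simp

lemma ae_exists_eq_true (hX : ∀ j, Measurable (X j)) (hindep : iIndepFun X P) {p : ℝ}
    (hp0 : 0 < p) (hlaw : ∀ j, P {ω | X j ω = true} = ENNReal.ofReal p) :
    ∀ᵐ ω ∂P, ∃ j, X j ω = true := by
  have hlim : Filter.Tendsto (fun j => ENNReal.ofReal (1 - p) ^ j) Filter.atTop (nhds 0) :=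
    ENNReal.tendsto_pow_atTop_nhds_zero_of_lt_one (by simpa using hp0)
  refine le_antisymm (ge_of_tendsto' hlim fun j => ?_) (zero_le)
  rw [← measure_forall_lt_eq_false hX hindep hp0.le hlaw j]
  refine measure_mono fun ω hω i _ => ?_
  by_contra h
  exact hω ⟨i, by simpa using h⟩

/-- Without a success, `sInf ∅ = 0` would make `numRuns` equal to `1`. -/
lemma lt_numRuns_iff {x : ℕ → Bool} (hx : ∃ j, x j = true) (j : ℕ) :
    j < numRuns x ↔ ∀ i < j, x i = false := by
  rw [numRuns, Nat.lt_succ_iff]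
  constructor
  · intro h i hi
    by_contra hne
    have : sInf {j | x j = true} ≤ i := Nat.sInf_le (by simpa using hne)
    omega
  · intro h
    by_contra! hlt
    have h1 := h _ hlt
    have h2 : x (sInf {j | x j = true}) = true := Nat.sInf_mem hx
    simp [h1] at h2

/-- The number of runs up to the first success is integrable, with mean `p⁻¹`. -/
lemma integrable_numRuns_and_integral (hX : ∀ j, Measurable (X j)) (hindep : iIndepFun X P)
    {p : ℝ} (hp0 : 0 < p) (hp1 : p ≤ 1)
    (hlaw : ∀ j, P {ω | X j ω = true} = ENNReal.ofReal p) :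
    Integrable (fun ω => (numRuns (fun j => X j ω) : ℝ)) P ∧
      ∫ ω, (numRuns (fun j => X j ω) : ℝ) ∂P = p⁻¹ := by
  let E (j : ℕ) : Set Ω := {ω | ∀ i < j, X i ω = false}
  have hE (j : ℕ) : MeasurableSet (E j) := by
    have : E j = ⋂ i ∈ Finset.range j, X i ⁻¹' {false} := by ext; simp [E]
    rw [this]
    exact Finset.measurableSet_biInter _ fun i _ => hX i (measurableSet_singleton _)
  -- Tail-sum formula: `G` counts the `j` for which the first `j` runs fail. It equals `numRuns`
  -- whenever a success occurs, and its integral is the geometric series `∑ (1 - p) ^ j`.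
  let G (ω : Ω) : ENNReal := ∑' j, (E j).indicator 1 ω
  have hG : Measurable G := Measurable.tsum fun j => measurable_one.indicator (hE j)
  have hint : ∫⁻ ω, G ω ∂P = ENNReal.ofReal p⁻¹ := by
    rw [lintegral_tsum fun j => (measurable_one.indicator (hE j)).aemeasurable]
    simp only [lintegral_indicator_one (hE _), E,
      measure_forall_lt_eq_false hX hindep hp0.le hlaw]
    rw [ENNReal.tsum_geometric, ENNReal.ofReal_inv_of_pos hp0, ← ENNReal.ofReal_one,
      ← ENNReal.ofReal_sub _ (by linarith)]
    congr 2
    ring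
  have hae : (fun ω => (numRuns (fun j => X j ω) : ℝ)) =ᵐ[P] fun ω => (G ω).toReal := by
    filter_upwards [ae_exists_eq_true hX hindep hp0 hlaw] with ω hω
    have : G ω = ∑ j ∈ Finset.range (numRuns fun j => X j ω), 1 := by
      refine (tsum_eq_sum (s := Finset.range (numRuns fun j => X j ω)) ?_).trans ?_
      · intro j hj
        exact Set.indicator_of_notMem (s := E j)
          (fun h => hj (Finset.mem_range.2 ((lt_numRuns_iff hω j).2 h))) 1
      · refine Finset.sum_congr rfl fun j hj => ?_
        exact Set.indicator_of_mem (s := E j) ((lt_numRuns_iff hω j).1 (Finset.mem_range.1 hj)) 1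
    rw [this]
    simp
  constructor
  · exact (integrable_toReal_of_lintegral_ne_top hG.aemeasurable (by simp [hint])).congr hae.symm
  · rw [integral_congr_ae hae, integral_toReal hG.aemeasurable
      (ae_lt_top hG (by simp [hint])), hint, ENNReal.toReal_ofReal (by positivity)]

end Geometric

end StabMagic

theorem mainTheorem1 {d : ℕ} [Fact d.Prime] (hd : d ≠ 2) {a b k m : ℕ}
    (ρ : Op d a) (hρ : IsState ρ) (σ : Op d b) (hσ : IsState σ)
    (Λ : StabProtocol d (m * b) (k * a))
    (hpos : 0 < Λ.successProb (tensorPow ρ k))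
    (hΛ : Λ.successState (tensorPow ρ k) = tensorPow σ m)
    -- independent runs of the protocol, each on `k` fresh copies of `ρ`
    {Ω : Type*} [MeasurableSpace Ω] (P : Measure Ω) [IsProbabilityMeasure P]
    (X : ℕ → Ω → Bool) (hX : ∀ j, Measurable (X j)) (hindep : iIndepFun X P)
    (hlaw : ∀ j, P {ω | X j ω = true} = ENNReal.ofReal (Λ.successProb (tensorPow ρ k))) :
    (∀ᵐ ω ∂P, ∃ j, X j ω = true) ∧
    Integrable (fun ω => (k : ℝ) * (numRuns (fun j => X j ω) : ℝ)) P ∧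
    (m : ℝ) * mana σ ≤ (∫ ω, (k : ℝ) * (numRuns (fun j => X j ω) : ℝ) ∂P) * mana ρ ∧
    (0 < mana ρ →
      ∫ ω, (k : ℝ) * (numRuns (fun j => X j ω) : ℝ) ∂P ≥ (m : ℝ) * (mana σ / mana ρ)) := by
  -- Read off from the law of `X 0`, which spares a proof that the failure branch has nonnegative
  -- trace.
  have hle : Λ.successProb (tensorPow ρ k) ≤ 1 := by
    rw [← ENNReal.ofReal_le_one, ← hlaw 0]
    exact prob_le_one
  obtain ⟨hint, hmean⟩ := integrable_numRuns_and_integral hX hindep hpos hle hlaw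
  have hmana := Λ.successProb_mul_mana_le hd hρ hσ hpos hle hΛ
  have hbound : (m : ℝ) * mana σ ≤
      (∫ ω, (k : ℝ) * (numRuns (fun j => X j ω) : ℝ) ∂P) * mana ρ := by
    rw [integral_const_mul, hmean, mul_right_comm, ← div_eq_mul_inv, le_div_iff₀' hpos]
    exact hmana
  refine ⟨ae_exists_eq_true hX hindep hpos hlaw, hint.const_mul _, hbound, fun h => ?_⟩
  rw [ge_iff_le, ← mul_div_assoc, div_le_iff₀ h]
  exact hbound
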